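/- Let $\alpha,\beta\in(1,2)$ and $d,e>0$. For $\gamma\in(1,2)$ put $f_\gamma(\xi)=-\frac{2-\gamma(1-e^{-\mathrm i\xi})}{2}\,\bigl(1+e^{\mathrm i(\xi+\pi)}\bigr)^{\gamma}$ (principal branch) and $q_\gamma(\xi)=f_\gamma(\xi)+f_\gamma(-\xi)$. Consider a sequence of discretizations with odd numbers of grid points $n_1,n_2$ and positive step sizes $h_x,h_y,\Delta t$ (all depending on the element of the sequence), set $N=n_1n_2$, $r=\frac{\Delta t}{2h_x^{\alpha}}$, $s=\frac{\Delta t}{2h_y^{\beta}}$, and assume that along the sequence $\frac1r=\frac{2h_x^\alpha}{\Delta t}=o(1)$ and that $\frac sr=\frac{h_x^\alpha}{h_y^\beta}$ is of order one, i.e. it is eventually bounded and bounded away from zero (in particular, $\frac sr$ may be a fixed positive constant). Let $$\mathcal F_{(\alpha,\beta)}(\theta_1,\theta_2)=d\,q_\alpha(\theta_1)+e\,\tfrac sr\,q_\beta(\theta_2),\qquad p(\theta_1,\theta_2)=(1+\cos\theta_1)(1+\cos\theta_2).$$ For an integrable function $g$ on $[-\pi,\pi]^2$ let $T_N^{(2)}(g)$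 be the $N\times N$ two-level Toeplitz matrix whose entry in row $(i_1,i_2)$ and column $(j_1,j_2)$ ($1\le i_\ell,j_\ell\le n_\ell$) is the Fourier coefficient $g_{(i_1-j_1,\,i_2-j_2)}$, where $g_{\mathbf k}=\frac1{(2\pi)^2}\int_{[-\pi,\pi]^2}g(\boldsymbol\theta)e^{-\mathrm i\langle\mathbf k,\boldsymbol\theta\rangle}d\boldsymbol\theta$. Let $k_\ell=(n_\ell-(n_\ell\bmod 2))/2$ (so $n_\ell=2k_\ell+1$), let $K_{n}^{k}\in\mathbb R^{n\times k}$ be the down-sampling matrix with entries $1$ if $i=2j-((n+1)\bmod 2)$ and $0$ otherwise, and put $k=k_1k_2$, $$A_N=T_N^{(2)}(\mathcal F_{(\alpha,\beta)}),\qquad D_N=\operatorname{diag}(A_N),\qquad P_N=T_N^{(2)}(p)\,\bigl(K_{n_1}^{k_1}\otimes K_{n_2}^{k_2}\bigr)\in\mathbb C^{N\times k}.$$ Then every $A_N$ is Hermitian positive definite, and there is $\xi>0$, independent of the element of the sequence (in particular of $N$), such that for every $\mathbf x\in\mathbb C^N$ $$\min_{\mathbf y\in\mathbb C^k}\|\mathbf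 x-P_N\mathbf y\|_{D_N}^2\le\xi\,\|\mathbf x\|_{A_N}^2,$$ where $\|\mathbf v\|_X=\|X^{1/2}\mathbf v\|_2$ for a positive definite matrix $X$. -/

import Mathlib

open Filter Asymptotics
open scoped Topology Kronecker ComplexOrder

noncomputable section

/-- Fourier coefficient `f_{(k₁,k₂)}` of a function `f` on `[-π,π]²`. -/
def fourierCoeff₂ (f : ℝ × ℝ → ℂ) (k₁ k₂ : ℤ) : ℂ :=
  1 / (2 * (Real.pi : ℂ)) ^ 2 *
    ∫ θ in Set.Icc (-Real.pi) Real.pi ×ˢ Set.Icc (-Real.pi) Real.pi,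
      f θ * Complex.exp (-Complex.I * ((k₁ : ℂ) * (θ.1 : ℂ) + (k₂ : ℂ) * (θ.2 : ℂ)))

/-- The 2-level Toeplitz matrix `T_N^{(2)}(f)`, `N = n₁ n₂`, with symbol `f`: the entry in
row `(i₁,i₂)` and column `(j₁,j₂)` is the Fourier coefficient `f_{(i₁-j₁, i₂-j₂)}`. -/
def toeplitz₂ (n₁ n₂ : ℕ) (f : ℝ × ℝ → ℂ) : Matrix (Fin n₁ × Fin n₂) (Fin n₁ × Fin n₂) ℂ :=
  fun i j => fourierCoeff₂ f ((i.1 : ℤ) - (j.1 : ℤ)) ((i.2 : ℤ) - (j.2 : ℤ))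

/-- The symbol of the (unscaled) WSGD discretization of a fractional derivative of order `γ`:
`f_γ(ξ) = -[(2 - γ(1 - e^{-iξ}))/2] (1 + e^{i(ξ+π)})^γ` (principal branch). -/
def wsgdSymbol (γ : ℝ) (ξ : ℝ) : ℂ :=
  -((2 - (γ : ℂ) * (1 - Complex.exp (-Complex.I * (ξ : ℂ)))) / 2) *
    (1 + Complex.exp (Complex.I * ((ξ : ℂ) + (Real.pi : ℂ)))) ^ (γ : ℂ)

/-- `q_γ(ξ) = f_γ(ξ) + f_γ(-ξ)`. -/
def qSymbol (γ : ℝ) (ξ : ℝ) : ℂ := wsgdSymbol γ ξ + wsgdSymbol γ (-ξ)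

/-- `𝓕_{(α,β)}(θ₁,θ₂) = d q_α(θ₁) + e (s/r) q_β(θ₂)`. -/
def Fsymbol (α β d e r s : ℝ) (θ : ℝ × ℝ) : ℂ :=
  (d : ℂ) * qSymbol α θ.1 + (e : ℂ) * ((s / r : ℝ) : ℂ) * qSymbol β θ.2

/-- The symbol `p(θ₁,θ₂) = (1 + cos θ₁)(1 + cos θ₂)` of the grid transfer operator. -/
def pSymbol (θ : ℝ × ℝ) : ℂ :=
  (((1 + Real.cos θ.1) * (1 + Real.cos θ.2) : ℝ) : ℂ)

/-- Number of coarse points `k = (n - (n mod 2)) / 2` in one dimension. -/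
def coarseSize (n : ℕ) : ℕ := (n - n % 2) / 2

/-- One-dimensional down-sampling matrix `K_n^k`. With the one-based indices `i + 1` and
`j + 1`, the entry is `1` iff `i + 1 = 2 (j + 1) - ((n + 1) mod 2)`. -/
def downSample (n : ℕ) : Matrix (Fin n) (Fin (coarseSize n)) ℂ :=
  fun i j => if (i : ℕ) + 1 = 2 * ((j : ℕ) + 1) - (n + 1) % 2 then 1 else 0

/-- The projector `P_N = T_N^{(2)}(p) (K_{n₁}^{k₁} ⊗ K_{n₂}^{k₂})`. -/
def projector (n₁ n₂ : ℕ) :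
    Matrix (Fin n₁ × Fin n₂) (Fin (coarseSize n₁) × Fin (coarseSize n₂)) ℂ :=
  toeplitz₂ n₁ n₂ pSymbol * (downSample n₁ ⊗ₖ downSample n₂)

/-- Squared energy norm `‖x‖²_X = ‖X^{1/2} x‖₂² = x^* X x` of a positive definite matrix. -/
def energySq {ι : Type*} [Fintype ι] (X : Matrix ι ι ℂ) (x : ι → ℂ) : ℝ :=
  (star x ⬝ᵥ X.mulVec x).re

/-- The mesh parameter `Δt / (2 h^γ)`; it is `r` for `(h_x, α)` and `s` for `(h_y, β)`. -/
def meshParam (Δt h γ : ℝ) : ℝ := Δt / (2 * h ^ γ)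

end

/-!
The quadratic form of `T(g)` is the integral of `g` against the squared modulus of a trigonometric
polynomial, so `g ↦ T(g)` is monotone. With the symbol `λ = (1 - cos θ₁) + (1 - cos θ₂)` of the
discrete Laplacian, a two-sided bound `c λ ≤ 𝓕 ≤ M` gives `c T(λ) ≤ A` and `D ≤ M`. It is uniform
along the sequence because `s / r` stays in a compact subset of `(0, ∞)`, and its lower half comes
from `q_γ(π - 2u) = (2 cos u)^γ (γ cos ((2 - γ) u) - (2 - γ) cos (γ u))`.

It remains to bound the interpolation error `E = 1 - P Kᵀ`, where `K = K₁ ⊗ K₂` and `Kᵀ x` serves as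
test vector. In one dimension `T(1 + cos) K Kᵀ = 1 - F X`, where `F` projects onto the points that
`K` drops and `X = T(1 - cos)`. Hence `E = 1 - (1 - F₁ X₁)(1 - F₂ X₂)`, and `0 ≤ Xᵢ ≤ 2` yields
`E* E ≤ 40 (X₁ + X₂) = 40 T(λ)`.
-/

section StarOrderedRing

variable {R : Type*} [Ring R] [PartialOrder R] [StarRing R] [StarOrderedRing R] {a b p q : R}

lemma star_add_mul_self_le (a b : R) :
    star (a + b) * (a + b) ≤ 2 • (star a * a + star b * b) := by
  rw [← sub_nonneg]
  convert star_mul_self_nonneg (a - b) using 1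
  simp only [star_add, star_sub]
  noncomm_ring

lemma star_sub_mul_self_le (a b : R) :
    star (a - b) * (a - b) ≤ 2 • (star a * a + star b * b) := by
  simpa [sub_eq_add_neg] using star_add_mul_self_le a (-b)

lemma mul_self_le_two_nsmul (ha : 0 ≤ a) (ha2 : a ≤ 2) : 2 • (a * a) ≤ 4 • a := by
  have h2 : (0 : R) ≤ 2 - a := sub_nonneg.2 ha2
  rw [← sub_nonneg]
  convert add_nonneg (conjugate_nonneg_of_nonneg h2 ha) (conjugate_nonneg_of_nonneg ha h2) using 1
  noncomm_ring

lemma star_mul_mul_self_le (hp : IsStarProjection p) (a : R) :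
    star (p * a) * (p * a) ≤ star a * a := by
  have hpp : star (p * a) * (p * a) = star a * p * a := by
    rw [star_mul, hp.isSelfAdjoint.star_eq, mul_assoc, ← mul_assoc p, hp.isIdempotentElem.eq,
      mul_assoc]
  simpa only [hpp, mul_one] using star_left_conjugate_le_conjugate hp.le_one a

lemma two_nsmul_star_mul_mul_self_le (hp : IsStarProjection p) (ha : 0 ≤ a) (ha2 : a ≤ 2) :
    2 • (star (p * a) * (p * a)) ≤ 4 • a := by
  calc 2 • (star (p * a) * (p * a)) ≤ 2 • (star a * a) :=
        nsmul_le_nsmul_right (star_mul_mul_self_le hp a) 2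
    _ = 2 • (a * a) := by rw [ha.star_eq]
    _ ≤ 4 • a := mul_self_le_two_nsmul ha ha2

lemma star_one_sub_mul_mul_self_le (hp : IsStarProjection p) (ha : 0 ≤ a) (ha2 : a ≤ 2) :
    star (1 - p * a) * (1 - p * a) ≤ 10 := by
  calc star (1 - p * a) * (1 - p * a)
      ≤ 2 • (star 1 * 1 + star (p * a) * (p * a)) := star_sub_mul_self_le 1 (p * a)
    _ = 2 + 2 • (star (p * a) * (p * a)) := by rw [star_one, mul_one, nsmul_add]; norm_num
    _ ≤ 2 + 4 • a := by grw [two_nsmul_star_mul_mul_self_le hp ha ha2]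
    _ ≤ 2 + 4 • 2 := by gcongr
    _ = 10 := by norm_num

theorem star_mul_self_one_sub_mul_le (hp : IsStarProjection p) (hq : IsStarProjection q)
    (ha : 0 ≤ a) (ha2 : a ≤ 2) (hb : 0 ≤ b) (hb2 : b ≤ 2) :
    star (1 - (1 - p * a) * (1 - q * b)) * (1 - (1 - p * a) * (1 - q * b)) ≤ 40 • (a + b) := by
  have hsplit : 1 - (1 - p * a) * (1 - q * b) = p * a + (1 - p * a) * (q * b) := by noncomm_ring
  have hcomp : star ((1 - p * a) * (q * b)) * ((1 - p * a) * (q * b)) ≤ 20 • b := by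
    calc star ((1 - p * a) * (q * b)) * ((1 - p * a) * (q * b))
        = star (q * b) * (star (1 - p * a) * (1 - p * a)) * (q * b) := by
          rw [star_mul]; noncomm_ring
      _ ≤ star (q * b) * 10 * (q * b) :=
          star_left_conjugate_le_conjugate (star_one_sub_mul_mul_self_le hp ha ha2) (q * b)
      _ = 5 • 2 • (star (q * b) * (q * b)) := by noncomm_ring
      _ ≤ 5 • 4 • b := nsmul_le_nsmul_right (two_nsmul_star_mul_mul_self_le hq hb hb2) 5
      _ = 20 • b := smul_smul 5 4 b
  calc star (1 - (1 - p * a) * (1 - q * b)) * (1 - (1 - p * a) * (1 - q * b))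
      ≤ 2 • (star (p * a) * (p * a)) +
          2 • (star ((1 - p * a) * (q * b)) * ((1 - p * a) * (q * b))) := by
        rw [hsplit, ← nsmul_add]; exact star_add_mul_self_le _ _
    _ ≤ 4 • a + 2 • 20 • b :=
        add_le_add (two_nsmul_star_mul_mul_self_le hp ha ha2) (nsmul_le_nsmul_right hcomp 2)
    _ ≤ 40 • (a + b) := by
        rw [smul_smul, nsmul_add]
        gcongr <;> norm_num

end StarOrderedRing

section EnergyNorm

open scoped Matrix MatrixOrder Matrix.Norms.L2Operator

variable {m n : Type*} [Fintype m] [Fintype n]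

lemma energySq_mono {X Y : Matrix n n ℂ} (h : X ≤ Y) (x : n → ℂ) : energySq X x ≤ energySq Y x := by
  have := (Complex.le_def.1 ((Matrix.le_iff.1 h).dotProduct_mulVec_nonneg x)).1
  rw [Matrix.sub_mulVec, dotProduct_sub, Complex.sub_re, Complex.zero_re] at this
  exact sub_nonneg.1 this

lemma energySq_smul (c : ℝ) (X : Matrix n n ℂ) (x : n → ℂ) :
    energySq (c • X) x = c * energySq X x := by
  simp only [energySq, Matrix.smul_mulVec, dotProduct_smul, Complex.smul_re, smul_eq_mul]

lemma energySq_mulVec (X : Matrix m m ℂ) (B : Matrix m n ℂ) (x : n → ℂ) :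
    energySq X (B *ᵥ x) = energySq (Bᴴ * X * B) x := by
  rw [energySq, energySq, Matrix.star_mulVec, ← Matrix.dotProduct_mulVec, Matrix.mulVec_mulVec,
    Matrix.mulVec_mulVec, Matrix.mul_assoc]

lemma energySq_one [DecidableEq n] (x : n → ℂ) :
    energySq 1 x = ‖WithLp.toLp 2 x‖ ^ 2 := by
  rw [energySq, Matrix.one_mulVec, dotProduct_comm, ← EuclideanSpace.inner_toLp_toLp,
    inner_self_eq_norm_sq_to_K]
  norm_cast

lemma exists_isMinOn_norm_sub_apply {𝕜 V W : Type*} [RCLike 𝕜] [AddCommGroup V] [Module 𝕜 V]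
    [FiniteDimensional 𝕜 V] [NormedAddCommGroup W] [InnerProductSpace 𝕜 W] (T : V →ₗ[𝕜] W) (u : W) :
    ∃ v, IsMinOn (fun z => ‖u - T z‖) Set.univ v := by
  obtain ⟨v, hv⟩ := T.range.starProjection_apply_mem u
  refine ⟨v, fun z _ => ?_⟩
  simp only [Set.mem_ofPred_eq, hv, Submodule.starProjection_minimal]
  have hbdd : BddBelow (Set.range fun w : T.range => ‖u - w‖) :=
    ⟨0, Set.forall_mem_range.2 fun _ => norm_nonneg _⟩
  exact ciInf_le hbdd ⟨T z, z, rfl⟩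

lemma exists_isMinOn_energySq_sub_mulVec {X : Matrix n n ℂ} (hX : X.PosSemidef)
    (B : Matrix n m ℂ) (x : n → ℂ) :
    ∃ y, IsMinOn (fun z => energySq X (x - B *ᵥ z)) Set.univ y := by
  classical
  obtain ⟨C, rfl⟩ := CStarAlgebra.nonneg_iff_eq_star_mul_self.1 hX.nonneg
  have henergy (z : m → ℂ) : energySq (star C * C) (x - B *ᵥ z) =
      ‖WithLp.toLp 2 (C *ᵥ x) - Matrix.toLpLin 2 2 (C * B) (WithLp.toLp 2 z)‖ ^ 2 := by
    rw [Matrix.toLpLin_apply, ← WithLp.toLp_sub, ← energySq_one, ← Matrix.mulVec_mulVec,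
      ← Matrix.mulVec_sub, energySq_mulVec, Matrix.mul_one, Matrix.star_eq_conjTranspose]
  obtain ⟨y, hy⟩ := exists_isMinOn_norm_sub_apply (Matrix.toLpLin 2 2 (C * B))
    (WithLp.toLp 2 (C *ᵥ x))
  refine ⟨y.ofLp, fun z hz => ?_⟩
  simp only [Set.mem_ofPred_eq, henergy]
  exact pow_le_pow_left₀ (norm_nonneg _) (hy hz) 2

lemma diagonal_diag_mono {ι : Type*} [DecidableEq ι] {X Y : Matrix ι ι ℂ} (h : X ≤ Y) :
    Matrix.diagonal X.diag ≤ Matrix.diagonal Y.diag := by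
  rw [Matrix.le_iff, Matrix.diagonal_sub, Matrix.posSemidef_diagonal_iff]
  exact fun i => (Matrix.le_iff.1 h).diag_nonneg

end EnergyNorm

noncomputable section TensorProduct

open MeasureTheory

/-- The Fourier coefficient `f_k` of a function `f` on `[-π,π]`, the one-dimensional analogue of
`fourierCoeff₂`. -/
def fourierCoeff₁ (f : ℝ → ℂ) (k : ℤ) : ℂ :=
  1 / (2 * (Real.pi : ℂ)) *
    ∫ u in Set.Icc (-Real.pi) Real.pi, f u * Complex.exp (-Complex.I * ((k : ℂ) * (u : ℂ)))

/-- The Toeplitz matrix `T_n(f)` with symbol `f`: the entry in row `i` and column `j` is the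
Fourier coefficient `f_{i-j}`. -/
def toeplitz₁ (n : ℕ) (f : ℝ → ℂ) : Matrix (Fin n) (Fin n) ℂ :=
  fun i j => fourierCoeff₁ f ((i : ℤ) - (j : ℤ))

lemma fourierCoeff₂_mul (f g : ℝ → ℂ) (k l : ℤ) :
    fourierCoeff₂ (fun θ => f θ.1 * g θ.2) k l = fourierCoeff₁ f k * fourierCoeff₁ g l := by
  have hsplit (θ : ℝ × ℝ) :
      f θ.1 * g θ.2 * Complex.exp (-Complex.I * ((k : ℂ) * (θ.1 : ℂ) + (l : ℂ) * (θ.2 : ℂ))) =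
        (f θ.1 * Complex.exp (-Complex.I * ((k : ℂ) * (θ.1 : ℂ)))) *
          (g θ.2 * Complex.exp (-Complex.I * ((l : ℂ) * (θ.2 : ℂ)))) := by
    rw [mul_mul_mul_comm, ← Complex.exp_add, mul_add]
  simp only [fourierCoeff₂, fourierCoeff₁, hsplit]
  rw [Measure.volume_eq_prod,
    setIntegral_prod_mul (fun u : ℝ => f u * Complex.exp (-Complex.I * ((k : ℂ) * (u : ℂ))))
      (fun u : ℝ => g u * Complex.exp (-Complex.I * ((l : ℂ) * (u : ℂ))))]
  ring

lemma toeplitz₂_mul (n₁ n₂ : ℕ) (f g : ℝ → ℂ) :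
    toeplitz₂ n₁ n₂ (fun θ => f θ.1 * g θ.2) = toeplitz₁ n₁ f ⊗ₖ toeplitz₁ n₂ g := by
  ext i j
  exact fourierCoeff₂_mul f g _ _

lemma fourierCoeff₁_one (k : ℤ) : fourierCoeff₁ (fun _ => 1) k = if k = 0 then 1 else 0 := by
  simp only [fourierCoeff₁, one_mul]
  rw [integral_Icc_eq_integral_Ioc,
    ← intervalIntegral.integral_of_le (by linarith [Real.pi_pos])]
  split_ifs with hk
  · have hconst : ∫ u : ℝ in -Real.pi..Real.pi, Complex.exp (-Complex.I * ((k : ℂ) * (u : ℂ))) =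
        2 * (Real.pi : ℂ) := by
      simp [hk, two_mul]
    rw [hconst, one_div_mul_cancel (by simp [Real.pi_ne_zero])]
  · have hperiod : -Complex.I * (k : ℂ) * (Real.pi : ℂ) =
        -Complex.I * (k : ℂ) * ((-Real.pi : ℝ) : ℂ) +
          ((-k : ℤ) : ℂ) * (2 * Real.pi * Complex.I) := by
      push_cast
      ring
    simp only [← mul_assoc]
    rw [integral_exp_mul_complex (by simp [hk]), hperiod, Complex.exp_add,
      Complex.exp_int_mul_two_pi_mul_I, mul_one, sub_self, zero_div, mul_zero]

lemma one_add_mul_cos_mul_exp (t u : ℝ) (k : ℤ) :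
    ((1 + t * Real.cos u : ℝ) : ℂ) * Complex.exp (-Complex.I * ((k : ℂ) * (u : ℂ))) =
      Complex.exp (-Complex.I * ((k : ℂ) * (u : ℂ))) +
        (t : ℂ) / 2 * Complex.exp (-Complex.I * (((k - 1 : ℤ) : ℂ) * (u : ℂ))) +
        (t : ℂ) / 2 * Complex.exp (-Complex.I * (((k + 1 : ℤ) : ℂ) * (u : ℂ))) := by
  have hpred : -Complex.I * (((k - 1 : ℤ) : ℂ) * (u : ℂ)) =
      u * Complex.I + -Complex.I * (k * (u : ℂ)) := by push_cast; ring
  have hsucc : -Complex.I * (((k + 1 : ℤ) : ℂ) * (u : ℂ)) =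
      -u * Complex.I + -Complex.I * (k * (u : ℂ)) := by push_cast; ring
  rw [hpred, hsucc, Complex.exp_add, Complex.exp_add]
  push_cast
  rw [Complex.cos]
  ring

lemma fourierCoeff₁_one_add_mul_cos (t : ℝ) (k : ℤ) :
    fourierCoeff₁ (fun u => ((1 + t * Real.cos u : ℝ) : ℂ)) k =
      if k = 0 then 1 else if k = 1 ∨ k = -1 then (t : ℂ) / 2 else 0 := by
  have hint (m : ℤ) : IntegrableOn (fun u : ℝ => Complex.exp (-Complex.I * ((m : ℂ) * (u : ℂ))))
      (Set.Icc (-Real.pi) Real.pi) :=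
    Continuous.integrableOn_Icc (by fun_prop)
  have hshift : fourierCoeff₁ (fun u => ((1 + t * Real.cos u : ℝ) : ℂ)) k =
      fourierCoeff₁ (fun _ => 1) k + t / 2 * fourierCoeff₁ (fun _ => 1) (k - 1) +
        t / 2 * fourierCoeff₁ (fun _ => 1) (k + 1) := by
    simp only [fourierCoeff₁, one_add_mul_cos_mul_exp, one_mul]
    rw [integral_add ((hint k).fun_add ((hint _).const_mul _)) ((hint _).const_mul _),
      integral_add (hint k) ((hint _).const_mul _), integral_const_mul, integral_const_mul]
    ring
  simp only [hshift, fourierCoeff₁_one, sub_eq_zero, add_eq_zero_iff_eq_neg]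
  rcases eq_or_ne k 0 with rfl | h0
  · simp
  rcases eq_or_ne k 1 with rfl | h1
  · norm_num
  rcases eq_or_ne k (-1) with rfl | h2
  · norm_num
  simp [h0, h1, h2]

/-- The tridiagonal Toeplitz matrix with diagonal entries `1` and off-diagonal entries `t / 2`,
generated by the symbol `1 + t cos`. -/
def tridiag (n : ℕ) (t : ℝ) : Matrix (Fin n) (Fin n) ℂ :=
  fun i j => if i = j then 1
    else if (i : ℕ) + 1 = j ∨ (j : ℕ) + 1 = i then (t : ℂ) / 2 else 0

lemma toeplitz₁_one_add_mul_cos (n : ℕ) (t : ℝ) :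
    toeplitz₁ n (fun u => ((1 + t * Real.cos u : ℝ) : ℂ)) = tridiag n t := by
  ext i j
  have hdiag : (i : ℤ) - j = 0 ↔ i = j := by omega
  have hoff : ((i : ℤ) - j = 1 ∨ (i : ℤ) - j = -1) ↔ ((i : ℕ) + 1 = j ∨ (j : ℕ) + 1 = i) := by
    omega
  simp only [toeplitz₁, tridiag, fourierCoeff₁_one_add_mul_cos, hdiag, hoff]

lemma toeplitz₂_one_add_mul_cos (n₁ n₂ : ℕ) (s t : ℝ) :
    toeplitz₂ n₁ n₂ (fun θ => (((1 + s * Real.cos θ.1) * (1 + t * Real.cos θ.2) : ℝ) : ℂ)) =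
      tridiag n₁ s ⊗ₖ tridiag n₂ t := by
  rw [← toeplitz₁_one_add_mul_cos, ← toeplitz₁_one_add_mul_cos, ← toeplitz₂_mul]
  simp only [Complex.ofReal_mul]

lemma tridiag_zero (n : ℕ) : tridiag n 0 = 1 := by
  ext i j
  simp [tridiag, Matrix.one_apply]

lemma toeplitz₂_one (n₁ n₂ : ℕ) : toeplitz₂ n₁ n₂ (fun _ => 1) = 1 := by
  simpa [tridiag_zero] using toeplitz₂_one_add_mul_cos n₁ n₂ 0 0

end TensorProduct

noncomputable section Toeplitz

open MeasureTheory
open scoped Matrix MatrixOrder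

/-- The square `[-π,π]²` on which symbols live and over which Fourier coefficients are taken. -/
def frequencySquare : Set (ℝ × ℝ) := Set.Icc (-Real.pi) Real.pi ×ˢ Set.Icc (-Real.pi) Real.pi

lemma isCompact_frequencySquare : IsCompact frequencySquare := isCompact_Icc.prod isCompact_Icc

/-- The trigonometric polynomial `∑ j, x_j e^{i⟨j,θ⟩}` with coefficient vector `x`, through which
the quadratic form of a Toeplitz matrix is an integral against its symbol. -/
def trigPoly {n₁ n₂ : ℕ} (x : Fin n₁ × Fin n₂ → ℂ) (θ : ℝ × ℝ) : ℂ :=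
  ∑ j, x j * Complex.exp (Complex.I * (((j.1 : ℕ) : ℂ) * (θ.1 : ℂ) + ((j.2 : ℕ) : ℂ) * (θ.2 : ℂ)))

variable {n₁ n₂ : ℕ} {f g : ℝ × ℝ → ℝ}

lemma integrableOn_of_continuous (hg : Continuous g) :
    IntegrableOn g frequencySquare :=
  hg.continuousOn.integrableOn_compact isCompact_frequencySquare

lemma integrableOn_ofReal_mul_exp (hg : IntegrableOn g frequencySquare) (k₁ k₂ : ℤ) :
    IntegrableOn (fun θ => (g θ : ℂ) *
      Complex.exp (-Complex.I * ((k₁ : ℂ) * (θ.1 : ℂ) + (k₂ : ℂ) * (θ.2 : ℂ)))) frequencySquare :=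
  IntegrableOn.mul_continuousOn hg.ofReal (by fun_prop) isCompact_frequencySquare

lemma toeplitz₂_ofReal_add (hf : IntegrableOn f frequencySquare)
    (hg : IntegrableOn g frequencySquare) :
    toeplitz₂ n₁ n₂ (fun θ => ((f θ + g θ : ℝ) : ℂ)) =
      toeplitz₂ n₁ n₂ (fun θ => (f θ : ℂ)) + toeplitz₂ n₁ n₂ (fun θ => (g θ : ℂ)) := by
  ext i j
  simp only [toeplitz₂, fourierCoeff₂, Matrix.add_apply, Complex.ofReal_add, add_mul, ← mul_add]
  congr 1
  exact integral_add (integrableOn_ofReal_mul_exp hf _ _) (integrableOn_ofReal_mul_exp hg _ _)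

lemma toeplitz₂_const_mul (c : ℂ) (f : ℝ × ℝ → ℂ) :
    toeplitz₂ n₁ n₂ (fun θ => c * f θ) = c • toeplitz₂ n₁ n₂ f := by
  ext i j
  simp only [toeplitz₂, fourierCoeff₂, Matrix.smul_apply, mul_assoc, integral_const_mul,
    smul_eq_mul]
  ring

lemma toeplitz₂_const (c : ℝ) : toeplitz₂ n₁ n₂ (fun _ => (c : ℂ)) = c • 1 := by
  simpa only [mul_one, toeplitz₂_one, Complex.coe_smul] using
    toeplitz₂_const_mul (n₁ := n₁) (n₂ := n₂) (c : ℂ) (fun _ => 1)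

lemma isHermitian_toeplitz₂ (g : ℝ × ℝ → ℝ) :
    (toeplitz₂ n₁ n₂ (fun θ => (g θ : ℂ))).IsHermitian := by
  ext i j
  simp only [toeplitz₂, fourierCoeff₂, Matrix.conjTranspose_apply, star_mul', RCLike.star_def]
  rw [← integral_conj]
  congr 1
  · simp only [map_div₀, map_pow, map_mul, map_one, Complex.conj_ofReal, Complex.conj_ofNat]
  · congr with θ
    rw [map_mul, Complex.conj_ofReal, ← Complex.exp_conj]
    simp only [map_mul, map_add, map_neg, Complex.conj_I, Complex.conj_ofReal, map_intCast]
    push_cast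
    ring_nf

lemma mul_norm_trigPoly_sq (c : ℂ) (x : Fin n₁ × Fin n₂ → ℂ) (θ : ℝ × ℝ) :
    c * ((‖trigPoly x θ‖ ^ 2 : ℝ) : ℂ) = ∑ i, ∑ j, star (x i) * x j *
      (c * Complex.exp (-Complex.I * ((((i.1 : ℤ) - (j.1 : ℤ) : ℤ) : ℂ) * (θ.1 : ℂ) +
        (((i.2 : ℤ) - (j.2 : ℤ) : ℤ) : ℂ) * (θ.2 : ℂ)))) := by
  rw [Complex.ofReal_pow, ← Complex.conj_mul', trigPoly, map_sum, Finset.sum_mul_sum,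
    Finset.mul_sum]
  refine Finset.sum_congr rfl fun i _ => ?_
  rw [Finset.mul_sum]
  refine Finset.sum_congr rfl fun j _ => ?_
  rw [map_mul, ← Complex.exp_conj]
  simp only [map_mul, map_add, Complex.conj_I, Complex.conj_ofReal, map_natCast]
  rw [mul_mul_mul_comm, ← Complex.exp_add, RCLike.star_def, mul_left_comm]
  push_cast
  ring_nf

lemma dotProduct_toeplitz₂_mulVec (hg : IntegrableOn g frequencySquare)
    (x : Fin n₁ × Fin n₂ → ℂ) :
    star x ⬝ᵥ toeplitz₂ n₁ n₂ (fun θ => (g θ : ℂ)) *ᵥ x =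
      ((1 / (2 * Real.pi) ^ 2 * ∫ θ in frequencySquare, g θ * ‖trigPoly x θ‖ ^ 2 : ℝ) : ℂ) := by
  have hint (k₁ k₂ : ℤ) (c : ℂ) := (integrableOn_ofReal_mul_exp hg k₁ k₂).const_mul c
  rw [Complex.ofReal_mul, ← integral_complex_ofReal]
  simp only [Complex.ofReal_mul (g _), mul_norm_trigPoly_sq]
  rw [integral_finsetSum _ fun i _ => integrable_finsetSum _ fun j _ => hint _ _ _]
  simp only [integral_finsetSum _ fun _ _ => hint _ _ _, integral_const_mul, Finset.mul_sum,
    dotProduct, Matrix.mulVec, Pi.star_apply]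
  refine Finset.sum_congr rfl fun i _ => Finset.sum_congr rfl fun j _ => ?_
  simp only [toeplitz₂, fourierCoeff₂, frequencySquare]
  push_cast
  ring

lemma posSemidef_toeplitz₂ (hg : IntegrableOn g frequencySquare)
    (hg0 : 0 ≤ᵐ[volume.restrict frequencySquare] g) :
    (toeplitz₂ n₁ n₂ (fun θ => (g θ : ℂ))).PosSemidef := by
  refine .of_dotProduct_mulVec_nonneg (isHermitian_toeplitz₂ g) fun x => ?_
  rw [dotProduct_toeplitz₂_mulVec hg]
  exact Complex.zero_le_real.2 <| mul_nonneg (by positivity) <| integral_nonneg_of_ae <|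
    hg0.mono fun θ hθ => mul_nonneg hθ (sq_nonneg _)

lemma toeplitz₂_mono (hf : IntegrableOn f frequencySquare) (hg : IntegrableOn g frequencySquare)
    (hfg : f ≤ᵐ[volume.restrict frequencySquare] g) :
    toeplitz₂ n₁ n₂ (fun θ => (f θ : ℂ)) ≤ toeplitz₂ n₁ n₂ (fun θ => (g θ : ℂ)) := by
  have hadd := toeplitz₂_ofReal_add (n₁ := n₁) (n₂ := n₂) hf (hg.sub hf)
  simp only [Pi.sub_apply, add_sub_cancel] at hadd
  rw [hadd, Matrix.le_iff, add_sub_cancel_left]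
  exact posSemidef_toeplitz₂ (hg.sub hf) (hfg.mono fun θ hθ => sub_nonneg.2 hθ)

lemma toeplitz₂_mem_Icc {a b : ℝ} (hg : Continuous g)
    (hab : ∀ θ, g θ ∈ Set.Icc a b) :
    toeplitz₂ n₁ n₂ (fun θ => (g θ : ℂ)) ∈ Set.Icc (a • 1) (b • 1) := by
  have hint := integrableOn_of_continuous hg
  rw [← toeplitz₂_const, ← toeplitz₂_const]
  exact ⟨toeplitz₂_mono (integrableOn_of_continuous continuous_const) hint
      (.of_forall fun θ => (hab θ).1),
    toeplitz₂_mono hint (integrableOn_of_continuous continuous_const)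
      (.of_forall fun θ => (hab θ).2)⟩

lemma eq_zero_of_trigPoly_ae_eq_zero {x : Fin n₁ × Fin n₂ → ℂ}
    (h : ∀ᵐ θ ∂volume.restrict frequencySquare, trigPoly x θ = 0) : x = 0 := by
  have hparseval := dotProduct_toeplitz₂_mulVec (g := fun _ => 1)
    (integrableOn_const isCompact_frequencySquare.measure_ne_top) x
  have hzero : ∫ θ in frequencySquare, 1 * ‖trigPoly x θ‖ ^ 2 = 0 :=
    integral_eq_zero_of_ae <| h.mono fun θ hθ => by simp [hθ]
  rw [hzero, mul_zero, Complex.ofReal_zero] at hparseval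
  simpa only [Complex.ofReal_one, toeplitz₂_one, Matrix.one_mulVec,
    dotProduct_star_self_eq_zero] using hparseval

lemma posDef_toeplitz₂ (hg : IntegrableOn g frequencySquare)
    (hg_pos : ∀ᵐ θ ∂volume.restrict frequencySquare, 0 < g θ) :
    (toeplitz₂ n₁ n₂ (fun θ => (g θ : ℂ))).PosDef := by
  refine .of_dotProduct_mulVec_pos (isHermitian_toeplitz₂ g) fun x hx => ?_
  have hg0 : 0 ≤ᵐ[volume.restrict frequencySquare] g := hg_pos.mono fun _ => le_of_lt
  refine ((posSemidef_toeplitz₂ hg hg0).dotProduct_mulVec_nonneg x).lt_of_ne' fun hform => hx ?_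
  rw [dotProduct_toeplitz₂_mulVec hg, Complex.ofReal_eq_zero,
    mul_eq_zero_iff_left (by positivity), setIntegral_eq_zero_iff_of_nonneg_ae] at hform
  · refine eq_zero_of_trigPoly_ae_eq_zero ?_
    filter_upwards [hform, hg_pos] with θ hθ hgθ
    simpa [hgθ.ne'] using hθ
  · exact hg0.mono fun θ hgθ => mul_nonneg hgθ (sq_nonneg _)
  · refine hg.mul_continuousOn ?_ isCompact_frequencySquare
    unfold trigPoly
    fun_prop

end Toeplitz

noncomputable section Coarsening

open scoped Matrix MatrixOrder Matrix.Norms.L2Operator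

/-- The coordinate projection onto the grid points which `downSample` drops. In the zero-based
numbering of `Fin n` the kept points are those with the parity of `n`. -/
def fineProj (n : ℕ) : Matrix (Fin n) (Fin n) ℂ :=
  Matrix.diagonal fun i => if Even ((i : ℕ) + n) then 0 else 1

lemma isStarProjection_fineProj (n : ℕ) : IsStarProjection (fineProj n) := by
  refine ⟨?_, ?_⟩
  · rw [IsIdempotentElem, fineProj, Matrix.diagonal_mul_diagonal]
    congr with i
    split_ifs <;> simp
  · rw [isSelfAdjoint_iff, fineProj, Matrix.star_eq_conjTranspose, Matrix.diagonal_conjTranspose]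
    congr with i
    simp only [Pi.star_apply]
    split_ifs <;> simp

lemma downSample_apply (n : ℕ) (i : Fin n) (l : Fin (coarseSize n)) :
    downSample n i l = if (i : ℕ) = 2 * l + n % 2 then 1 else 0 := by
  have hindex : (i : ℕ) + 1 = 2 * ((l : ℕ) + 1) - (n + 1) % 2 ↔ (i : ℕ) = 2 * l + n % 2 := by
    omega
  simp only [downSample, hindex]

lemma downSample_mul_transpose (n : ℕ) : downSample n * (downSample n)ᵀ = 1 - fineProj n := by
  ext i j
  simp only [Matrix.mul_apply, Matrix.transpose_apply, downSample_apply, ite_mul, one_mul,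
    zero_mul, Matrix.sub_apply, Matrix.one_apply, fineProj, Matrix.diagonal_apply]
  by_cases hi : Even ((i : ℕ) + n)
  · have hlt : (i : ℕ) / 2 < coarseSize n := by unfold coarseSize; grind
    rw [Finset.sum_eq_single ⟨(i : ℕ) / 2, hlt⟩]
    · grind
    · grind
    · simp
  · rw [Finset.sum_eq_zero]
    · grind
    · grind

-- Neighbouring grid points have opposite parity, so the off-diagonal part of `tridiag` couples only
-- kept points with dropped ones.
lemma tridiag_mul_one_sub_fineProj (n : ℕ) (t : ℝ) :
    tridiag n t * (1 - fineProj n) = 1 - fineProj n * tridiag n (-t) := by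
  rw [mul_sub, mul_one]
  ext i j
  simp only [fineProj, Matrix.sub_apply, Matrix.mul_diagonal, Matrix.diagonal_mul, tridiag,
    Matrix.one_apply]
  push_cast
  grind

lemma isStarProjection_kronecker {m n : Type*} [Fintype m] [Fintype n]
    {p : Matrix m m ℂ} {q : Matrix n n ℂ} (hp : IsStarProjection p) (hq : IsStarProjection q) :
    IsStarProjection (p ⊗ₖ q) := by
  refine ⟨?_, ?_⟩
  · rw [IsIdempotentElem, ← Matrix.mul_kronecker_mul, hp.isIdempotentElem.eq,
      hq.isIdempotentElem.eq]
  · rw [isSelfAdjoint_iff, Matrix.star_eq_conjTranspose, Matrix.conjTranspose_kronecker,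
      ← Matrix.star_eq_conjTranspose, ← Matrix.star_eq_conjTranspose, hp.isSelfAdjoint.star_eq,
      hq.isSelfAdjoint.star_eq]

lemma one_sub_kronecker_one {m n : Type*} [DecidableEq m] [DecidableEq n] (A : Matrix m m ℂ) :
    (1 - A) ⊗ₖ (1 : Matrix n n ℂ) = 1 - A ⊗ₖ 1 := by
  rw [← Matrix.one_kronecker_one]
  ext i j
  simp only [Matrix.kroneckerMap_apply, Matrix.sub_apply, sub_mul]

lemma one_kronecker_one_sub {m n : Type*} [DecidableEq m] [DecidableEq n] (B : Matrix n n ℂ) :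
    (1 : Matrix m m ℂ) ⊗ₖ (1 - B) = 1 - 1 ⊗ₖ B := by
  rw [← Matrix.one_kronecker_one]
  ext i j
  simp only [Matrix.kroneckerMap_apply, Matrix.sub_apply, mul_sub]

lemma projector_mul_transpose_downSample (n₁ n₂ : ℕ) :
    projector n₁ n₂ * (downSample n₁ ⊗ₖ downSample n₂)ᵀ =
      (1 - (fineProj n₁ ⊗ₖ 1) * (tridiag n₁ (-1) ⊗ₖ 1)) *
        (1 - (1 ⊗ₖ fineProj n₂) * (1 ⊗ₖ tridiag n₂ (-1))) := by
  have hp : toeplitz₂ n₁ n₂ pSymbol = tridiag n₁ 1 ⊗ₖ tridiag n₂ 1 := by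
    simp only [← toeplitz₂_one_add_mul_cos, one_mul]
    rfl
  rw [projector, hp, Matrix.mul_assoc, ← Matrix.kroneckerMap_transpose, ← Matrix.mul_kronecker_mul,
    ← Matrix.mul_kronecker_mul, downSample_mul_transpose, downSample_mul_transpose,
    tridiag_mul_one_sub_fineProj, tridiag_mul_one_sub_fineProj, ← Matrix.mul_kronecker_mul,
    ← Matrix.mul_kronecker_mul, one_mul, one_mul, ← one_sub_kronecker_one,
    ← one_kronecker_one_sub, ← Matrix.mul_kronecker_mul, one_mul, mul_one]

/-- The symbol `(1 - cos θ₁) + (1 - cos θ₂)` of the five-point discrete Laplacian, to which the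
symbols of the discretization are compared. -/
def laplaceSymbol (θ : ℝ × ℝ) : ℝ := (1 - Real.cos θ.1) + (1 - Real.cos θ.2)

lemma tridiag_kronecker_one (n₁ n₂ : ℕ) :
    tridiag n₁ (-1) ⊗ₖ 1 = toeplitz₂ n₁ n₂ (fun θ => ((1 - Real.cos θ.1 : ℝ) : ℂ)) := by
  simpa only [tridiag_zero, neg_one_mul, zero_mul, add_zero, mul_one, ← sub_eq_add_neg] using
    (toeplitz₂_one_add_mul_cos n₁ n₂ (-1) 0).symm

lemma one_kronecker_tridiag (n₁ n₂ : ℕ) :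
    1 ⊗ₖ tridiag n₂ (-1) = toeplitz₂ n₁ n₂ (fun θ => ((1 - Real.cos θ.2 : ℝ) : ℂ)) := by
  simpa only [tridiag_zero, neg_one_mul, zero_mul, add_zero, one_mul, ← sub_eq_add_neg] using
    (toeplitz₂_one_add_mul_cos n₁ n₂ 0 (-1)).symm

lemma toeplitz₂_laplaceSymbol (n₁ n₂ : ℕ) :
    toeplitz₂ n₁ n₂ (fun θ => (laplaceSymbol θ : ℂ)) =
      tridiag n₁ (-1) ⊗ₖ 1 + 1 ⊗ₖ tridiag n₂ (-1) := by
  rw [tridiag_kronecker_one, one_kronecker_tridiag]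
  exact toeplitz₂_ofReal_add (integrableOn_of_continuous (by fun_prop))
    (integrableOn_of_continuous (by fun_prop))

lemma star_mul_self_one_sub_projector_le (n₁ n₂ : ℕ) :
    star (1 - projector n₁ n₂ * (downSample n₁ ⊗ₖ downSample n₂)ᵀ) *
        (1 - projector n₁ n₂ * (downSample n₁ ⊗ₖ downSample n₂)ᵀ) ≤
      40 • toeplitz₂ n₁ n₂ (fun θ => (laplaceSymbol θ : ℂ)) := by
  have hcos (u : ℝ) : 1 - Real.cos u ∈ Set.Icc 0 2 :=
    ⟨sub_nonneg.2 (Real.cos_le_one u), by linarith [Real.neg_one_le_cos u]⟩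
  have h₁ := toeplitz₂_mem_Icc (n₁ := n₁) (n₂ := n₂) (g := fun θ => 1 - Real.cos θ.1)
    (by fun_prop) fun θ => hcos θ.1
  have h₂ := toeplitz₂_mem_Icc (n₁ := n₁) (n₂ := n₂) (g := fun θ => 1 - Real.cos θ.2)
    (by fun_prop) fun θ => hcos θ.2
  simp only [zero_smul, ofNat_smul_eq_nsmul, nsmul_one, Nat.cast_ofNat] at h₁ h₂
  rw [← tridiag_kronecker_one] at h₁
  rw [← one_kronecker_tridiag] at h₂
  rw [projector_mul_transpose_downSample, toeplitz₂_laplaceSymbol]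
  exact star_mul_self_one_sub_mul_le
    (isStarProjection_kronecker (isStarProjection_fineProj n₁) (.one _))
    (isStarProjection_kronecker (.one _) (isStarProjection_fineProj n₂)) h₁.1 h₁.2 h₂.1 h₂.2

end Coarsening

section ApproximationProperty

open MeasureTheory
open scoped Matrix MatrixOrder Matrix.Norms.L2Operator

variable {n₁ n₂ : ℕ} {g : ℝ × ℝ → ℝ} {c M : ℝ}

lemma laplaceSymbol_nonneg (θ : ℝ × ℝ) : 0 ≤ laplaceSymbol θ :=
  add_nonneg (sub_nonneg.2 (Real.cos_le_one _)) (sub_nonneg.2 (Real.cos_le_one _))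

lemma laplaceSymbol_pos {θ : ℝ × ℝ} (hθ : θ ∈ frequencySquare) (h0 : θ ≠ 0) :
    0 < laplaceSymbol θ := by
  refine (laplaceSymbol_nonneg θ).lt_of_ne' fun hzero => h0 ?_
  have hcos₁ := Real.cos_le_one θ.1
  have hcos₂ := Real.cos_le_one θ.2
  have hpi := Real.pi_pos
  rw [laplaceSymbol] at hzero
  exact Prod.ext
    ((Real.cos_eq_one_iff_of_lt_of_lt (by linarith [hθ.1.1]) (by linarith [hθ.1.2])).1
      (by linarith))
    ((Real.cos_eq_one_iff_of_lt_of_lt (by linarith [hθ.2.1]) (by linarith [hθ.2.2])).1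
      (by linarith))

lemma continuous_laplaceSymbol : Continuous laplaceSymbol := by
  unfold laplaceSymbol
  fun_prop

theorem posDef_toeplitz₂_of_laplaceSymbol_le (hc : 0 < c) (hg : IntegrableOn g frequencySquare)
    (hcg : ∀ᵐ θ ∂volume.restrict frequencySquare, c * laplaceSymbol θ ≤ g θ) :
    (toeplitz₂ n₁ n₂ (fun θ => (g θ : ℂ))).PosDef := by
  refine posDef_toeplitz₂ hg ?_
  filter_upwards [hcg, ae_restrict_mem isCompact_frequencySquare.measurableSet,
    Measure.ae_ne (volume.restrict frequencySquare) 0] with θ hle hθ h0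
  exact (mul_pos hc (laplaceSymbol_pos hθ h0)).trans_le hle

lemma smul_toeplitz₂_laplaceSymbol_le (hg : IntegrableOn g frequencySquare)
    (hcg : ∀ᵐ θ ∂volume.restrict frequencySquare, c * laplaceSymbol θ ≤ g θ) :
    c • toeplitz₂ n₁ n₂ (fun θ => (laplaceSymbol θ : ℂ)) ≤
      toeplitz₂ n₁ n₂ (fun θ => (g θ : ℂ)) := by
  rw [← Complex.coe_smul, ← toeplitz₂_const_mul]
  simp only [← Complex.ofReal_mul]
  exact toeplitz₂_mono
    (integrableOn_of_continuous (continuous_const.mul continuous_laplaceSymbol)) hg hcg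

lemma diagonal_diag_toeplitz₂_le (hg : IntegrableOn g frequencySquare)
    (hgM : ∀ᵐ θ ∂volume.restrict frequencySquare, g θ ≤ M) :
    Matrix.diagonal (toeplitz₂ n₁ n₂ (fun θ => (g θ : ℂ))).diag ≤ M • 1 := by
  have hle := toeplitz₂_mono (n₁ := n₁) (n₂ := n₂) hg
    (integrableOn_of_continuous (g := fun _ => M) continuous_const) hgM
  rw [toeplitz₂_const] at hle
  simpa only [Matrix.diag_smul, Matrix.diag_one, Matrix.diagonal_smul,
    Pi.one_def, Matrix.diagonal_one] using
    diagonal_diag_mono hle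

theorem exists_isMinOn_energySq_sub_projector_mulVec (hc : 0 < c) (hM : 0 ≤ M)
    (hg : IntegrableOn g frequencySquare)
    (hcg : ∀ᵐ θ ∂volume.restrict frequencySquare, c * laplaceSymbol θ ≤ g θ)
    (hgM : ∀ᵐ θ ∂volume.restrict frequencySquare, g θ ≤ M) (x : Fin n₁ × Fin n₂ → ℂ) :
    ∃ y, IsMinOn (fun z => energySq
        (Matrix.diagonal (toeplitz₂ n₁ n₂ (fun θ => (g θ : ℂ))).diag)
        (x - projector n₁ n₂ *ᵥ z)) Set.univ y ∧
      energySq (Matrix.diagonal (toeplitz₂ n₁ n₂ (fun θ => (g θ : ℂ))).diag)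
          (x - projector n₁ n₂ *ᵥ y) ≤
        40 * M / c * energySq (toeplitz₂ n₁ n₂ (fun θ => (g θ : ℂ))) x := by
  set A := toeplitz₂ n₁ n₂ (fun θ => (g θ : ℂ))
  set E := 1 - projector n₁ n₂ * (downSample n₁ ⊗ₖ downSample n₂)ᵀ
  have hD : (Matrix.diagonal A.diag).PosSemidef := Matrix.posSemidef_diagonal_iff.2 fun i =>
    (posDef_toeplitz₂_of_laplaceSymbol_le hc hg hcg).posSemidef.diag_nonneg
  have hE : energySq 1 (E *ᵥ x) ≤
      40 * energySq (toeplitz₂ n₁ n₂ (fun θ => (laplaceSymbol θ : ℂ))) x := by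
    rw [energySq_mulVec, Matrix.mul_one, ← energySq_smul, ofNat_smul_eq_nsmul ℝ]
    exact energySq_mono (star_mul_self_one_sub_projector_le n₁ n₂) x
  have hA : energySq (toeplitz₂ n₁ n₂ (fun θ => (laplaceSymbol θ : ℂ))) x ≤ energySq A x / c := by
    rw [le_div_iff₀' hc, ← energySq_smul]
    exact energySq_mono (smul_toeplitz₂_laplaceSymbol_le hg hcg) x
  obtain ⟨y, hy⟩ := exists_isMinOn_energySq_sub_mulVec hD (projector n₁ n₂) x
  refine ⟨y, hy, ?_⟩
  calc energySq (Matrix.diagonal A.diag) (x - projector n₁ n₂ *ᵥ y)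
      ≤ energySq (Matrix.diagonal A.diag)
          (x - projector n₁ n₂ *ᵥ ((downSample n₁ ⊗ₖ downSample n₂)ᵀ *ᵥ x)) := hy (Set.mem_univ _)
    _ = energySq (Matrix.diagonal A.diag) (E *ᵥ x) := by
        rw [Matrix.sub_mulVec, Matrix.one_mulVec, Matrix.mulVec_mulVec]
    _ ≤ M * energySq 1 (E *ᵥ x) := by
        rw [← energySq_smul]
        exact energySq_mono (diagonal_diag_toeplitz₂_le hg hgM) _
    _ ≤ M * (40 * (energySq A x / c)) := by grw [hE, hA]
    _ = 40 * M / c * energySq A x := by ring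

end ApproximationProperty

section WSGDSymbol

open MeasureTheory

variable {γ u ξ : ℝ}

lemma one_add_exp_add_pi (ξ : ℝ) :
    1 + Complex.exp (Complex.I * ((ξ : ℂ) + (Real.pi : ℂ))) = 1 - Complex.exp (ξ * Complex.I) := by
  rw [mul_comm, add_mul, Complex.exp_add, Complex.exp_pi_mul_I, mul_neg_one, sub_eq_add_neg]

lemma norm_wsgdSymbol_le (hγ : γ ∈ Set.Icc 0 2) (ξ : ℝ) : ‖wsgdSymbol γ ξ‖ ≤ 4 := by
  have hpoly : ‖-((2 - (γ : ℂ) * (1 - Complex.exp (-Complex.I * (ξ : ℂ)))) / 2)‖ ≤ 1 := by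
    have hexp : ‖Complex.exp (-Complex.I * (ξ : ℂ))‖ = 1 := by
      simpa [mul_comm] using Complex.norm_exp_ofReal_mul_I (-ξ)
    have hsplit : 2 - (γ : ℂ) * (1 - Complex.exp (-Complex.I * (ξ : ℂ))) =
        ((2 - γ : ℝ) : ℂ) + γ * Complex.exp (-Complex.I * (ξ : ℂ)) := by
      push_cast
      ring
    have htri := norm_add_le ((2 - γ : ℝ) : ℂ) (γ * Complex.exp (-Complex.I * (ξ : ℂ)))
    rw [norm_mul, hexp, Complex.norm_of_nonneg (sub_nonneg.2 hγ.2),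
      Complex.norm_of_nonneg hγ.1] at htri
    rw [norm_neg, norm_div, hsplit, Complex.norm_ofNat]
    linarith
  have hbase : ‖1 - Complex.exp (ξ * Complex.I)‖ ≤ 2 := by
    refine (norm_sub_le _ _).trans_eq ?_
    rw [norm_one, Complex.norm_exp_ofReal_mul_I]
    norm_num
  rw [wsgdSymbol, one_add_exp_add_pi, norm_mul, Complex.norm_cpow_real]
  calc _ ≤ 1 * ‖1 - Complex.exp (ξ * Complex.I)‖ ^ γ := by gcongr
    _ ≤ 2 ^ γ := by rw [one_mul]; exact Real.rpow_le_rpow (norm_nonneg _) hbase hγ.1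
    _ ≤ 2 ^ (2 : ℝ) := Real.rpow_le_rpow_of_exponent_le one_le_two hγ.2
    _ = 4 := by norm_num

lemma norm_qSymbol_le (hγ : γ ∈ Set.Icc 0 2) (ξ : ℝ) : ‖qSymbol γ ξ‖ ≤ 8 := by
  refine (norm_add_le _ _).trans ?_
  linarith [norm_wsgdSymbol_le hγ ξ, norm_wsgdSymbol_le hγ (-ξ)]

@[fun_prop]
lemma measurable_qSymbol (γ : ℝ) : Measurable (qSymbol γ) := by
  unfold qSymbol wsgdSymbol
  fun_prop

lemma wsgdSymbol_neg (γ ξ : ℝ) : wsgdSymbol γ (-ξ) = starRingEnd ℂ (wsgdSymbol γ ξ) := by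
  have harg : (1 - Complex.exp (ξ * Complex.I)).arg ≠ Real.pi := fun h => by
    have hre := (Complex.arg_eq_pi_iff.1 h).1
    rw [Complex.sub_re, Complex.one_re, Complex.exp_ofReal_mul_I_re] at hre
    linarith [Real.cos_le_one ξ]
  have hbase : 1 - Complex.exp (((-ξ : ℝ) : ℂ) * Complex.I) =
      starRingEnd ℂ (1 - Complex.exp (ξ * Complex.I)) := by
    simp only [map_sub, map_one, ← Complex.exp_conj, map_mul, Complex.conj_ofReal, Complex.conj_I,
      Complex.ofReal_neg, neg_mul, mul_neg]
  have hpoly : 1 - Complex.exp (-Complex.I * ((-ξ : ℝ) : ℂ)) =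
      starRingEnd ℂ (1 - Complex.exp (-Complex.I * ξ)) := by
    simp only [map_sub, map_one, ← Complex.exp_conj, map_mul, Complex.conj_ofReal, Complex.conj_I,
      map_neg, Complex.ofReal_neg, neg_mul, mul_neg]
  rw [wsgdSymbol, wsgdSymbol, one_add_exp_add_pi, one_add_exp_add_pi, hbase, hpoly,
    Complex.conj_cpow _ _ harg, Complex.conj_ofReal]
  simp only [map_mul, map_neg, map_div₀, map_sub (starRingEnd ℂ) 2, Complex.conj_ofReal,
    Complex.conj_ofNat]

lemma qSymbol_eq_ofReal (γ ξ : ℝ) : qSymbol γ ξ = ((2 * (wsgdSymbol γ ξ).re : ℝ) : ℂ) := by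
  rw [qSymbol, wsgdSymbol_neg, Complex.add_conj]

lemma qSymbol_neg (γ ξ : ℝ) : qSymbol γ (-ξ) = qSymbol γ ξ := by
  rw [qSymbol, qSymbol, neg_neg, add_comm]

lemma qSymbol_zero (hγ : γ ≠ 0) : qSymbol γ 0 = 0 := by
  simp [qSymbol, wsgdSymbol, mul_comm Complex.I, Complex.exp_pi_mul_I, hγ]

lemma one_sub_exp_pi_sub_two_mul (u : ℝ) :
    1 - Complex.exp ((Real.pi - 2 * u : ℝ) * Complex.I) =
      ((2 * Real.cos u : ℝ) : ℂ) * Complex.exp ((-u : ℝ) * Complex.I) := by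
  have hrotate : ((Real.pi - 2 * u : ℝ) : ℂ) * Complex.I =
      (-u : ℝ) * Complex.I + (-u : ℝ) * Complex.I + Real.pi * Complex.I := by
    push_cast
    ring
  have hunit : Complex.exp (u * Complex.I) * Complex.exp ((-u : ℝ) * Complex.I) = 1 := by
    rw [← Complex.exp_add]
    simp
  rw [hrotate, Complex.exp_add, Complex.exp_add, Complex.exp_pi_mul_I, Complex.ofReal_mul,
    Complex.ofReal_cos, Complex.ofReal_ofNat, Complex.two_cos, add_mul, hunit,
    Complex.ofReal_neg]
  ring

lemma ofReal_mul_exp_mul_I_cpow {ρ φ : ℝ} (hρ : 0 < ρ) (hφ : φ ∈ Set.Ioc (-Real.pi) Real.pi)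
    (γ : ℝ) :
    ((ρ : ℂ) * Complex.exp (φ * Complex.I)) ^ (γ : ℂ) =
      ((ρ ^ γ : ℝ) : ℂ) * Complex.exp ((γ * φ : ℝ) * Complex.I) := by
  have hlog : Complex.log (Complex.exp (φ * Complex.I)) = φ * Complex.I :=
    Complex.log_exp (by simpa using hφ.1) (by simpa using hφ.2)
  rw [Complex.cpow_def_of_ne_zero
      (mul_ne_zero (Complex.ofReal_ne_zero.2 hρ.ne') (Complex.exp_ne_zero _)),
    Complex.log_ofReal_mul hρ (Complex.exp_ne_zero _), hlog, Real.rpow_def_of_pos hρ,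
    Complex.ofReal_exp, ← Complex.exp_add]
  push_cast
  ring_nf

lemma wsgdSymbol_pi_sub_two_mul (hu : u ∈ Set.Ico 0 (Real.pi / 2)) (γ : ℝ) :
    wsgdSymbol γ (Real.pi - 2 * u) = ((1 / 2 * (2 * Real.cos u) ^ γ : ℝ) : ℂ) *
      (γ * Complex.exp (((2 - γ) * u : ℝ) * Complex.I) -
        ((2 - γ : ℝ) : ℂ) * Complex.exp ((-(γ * u) : ℝ) * Complex.I)) := by
  have hcos : 0 < Real.cos u := Real.cos_pos_of_mem_Ioo ⟨by linarith [Real.pi_pos, hu.1], hu.2⟩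
  have hexp : Complex.exp (-Complex.I * ((Real.pi - 2 * u : ℝ) : ℂ)) =
      -Complex.exp ((2 * u : ℝ) * Complex.I) := by
    have hrotate : -Complex.I * ((Real.pi - 2 * u : ℝ) : ℂ) =
        (2 * u : ℝ) * Complex.I - Real.pi * Complex.I := by
      push_cast
      ring
    rw [hrotate, Complex.exp_sub, Complex.exp_pi_mul_I, div_neg, div_one]
  have hmul : Complex.exp (((2 - γ) * u : ℝ) * Complex.I) =
      Complex.exp ((2 * u : ℝ) * Complex.I) * Complex.exp ((-(γ * u) : ℝ) * Complex.I) := by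
    rw [← Complex.exp_add]
    push_cast
    ring_nf
  rw [wsgdSymbol, one_add_exp_add_pi, one_sub_exp_pi_sub_two_mul,
    ofReal_mul_exp_mul_I_cpow (by positivity)
      ⟨by linarith [Real.pi_pos, hu.2], by linarith [Real.pi_pos, hu.1]⟩, hexp, hmul, mul_neg]
  push_cast
  ring

lemma qSymbol_pi_sub_two_mul_re (hu : u ∈ Set.Ico 0 (Real.pi / 2)) (γ : ℝ) :
    (qSymbol γ (Real.pi - 2 * u)).re =
      (2 * Real.cos u) ^ γ * (γ * Real.cos ((2 - γ) * u) - (2 - γ) * Real.cos (γ * u)) := by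
  rw [qSymbol_eq_ofReal, Complex.ofReal_re, wsgdSymbol_pi_sub_two_mul hu, Complex.re_ofReal_mul,
    Complex.sub_re, Complex.re_ofReal_mul, Complex.re_ofReal_mul, Complex.exp_ofReal_mul_I_re,
    Complex.exp_ofReal_mul_I_re, Real.cos_neg]
  ring

/-- The constant `c_γ = (γ - 1) cos ((2 - γ) π / 2)` in the lower bound
`c_γ (1 - cos ξ) ≤ q_γ(ξ)` on `[-π,π]`. -/
noncomputable def qLowerConst (γ : ℝ) : ℝ := (γ - 1) * Real.cos ((2 - γ) * (Real.pi / 2))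

lemma qLowerConst_pos (hγ : γ ∈ Set.Ioc 1 2) : 0 < qLowerConst γ := by
  obtain ⟨h1, h2⟩ := hγ
  refine mul_pos (by linarith) (Real.cos_pos_of_mem_Ioo ⟨?_, ?_⟩) <;> nlinarith [Real.pi_pos]

lemma sq_le_two_mul_rpow {c : ℝ} (hγ : γ ∈ Set.Icc 0 2) (hc : c ∈ Set.Ioc 0 1) :
    c ^ 2 ≤ (2 * c) ^ γ := by
  calc c ^ 2 = c ^ (2 : ℝ) := (Real.rpow_two c).symm
    _ ≤ c ^ γ := Real.rpow_le_rpow_of_exponent_ge hc.1 hc.2 hγ.2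
    _ ≤ (2 * c) ^ γ := Real.rpow_le_rpow hc.1.le (by linarith [hc.1]) hγ.1

lemma two_mul_qLowerConst_le (hγ : γ ∈ Set.Icc 1 2) (hu : u ∈ Set.Icc 0 (Real.pi / 2)) :
    2 * qLowerConst γ ≤ γ * Real.cos ((2 - γ) * u) - (2 - γ) * Real.cos (γ * u) := by
  obtain ⟨h1, h2⟩ := hγ
  obtain ⟨h0, hpi⟩ := hu
  have hedge : Real.cos ((2 - γ) * (Real.pi / 2)) ≤ Real.cos ((2 - γ) * u) := by
    refine Real.cos_le_cos_of_nonneg_of_le_pi ?_ ?_ ?_ <;> nlinarith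
  have horder : Real.cos (γ * u) ≤ Real.cos ((2 - γ) * u) := by
    refine Real.cos_le_cos_of_nonneg_of_le_pi ?_ ?_ ?_ <;> nlinarith
  calc 2 * qLowerConst γ ≤ 2 * ((γ - 1) * Real.cos ((2 - γ) * u)) := by
        have : 0 ≤ γ - 1 := sub_nonneg.2 h1
        rw [qLowerConst]
        gcongr
    _ = γ * Real.cos ((2 - γ) * u) - (2 - γ) * Real.cos ((2 - γ) * u) := by ring
    _ ≤ γ * Real.cos ((2 - γ) * u) - (2 - γ) * Real.cos (γ * u) := by
        have : 0 ≤ 2 - γ := sub_nonneg.2 h2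
        gcongr

lemma qLowerConst_mul_le_of_pos (hγ : γ ∈ Set.Ioc 1 2) (hξ : ξ ∈ Set.Ioc 0 Real.pi) :
    qLowerConst γ * (1 - Real.cos ξ) ≤ (qSymbol γ ξ).re := by
  obtain ⟨u, rfl⟩ : ∃ u, ξ = Real.pi - 2 * u := ⟨(Real.pi - ξ) / 2, by ring⟩
  have hu : u ∈ Set.Ico 0 (Real.pi / 2) := ⟨by linarith [hξ.2], by linarith [hξ.1]⟩
  have hcos : 0 < Real.cos u := Real.cos_pos_of_mem_Ioo ⟨by linarith [Real.pi_pos, hu.1], hu.2⟩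
  have hconst := qLowerConst_pos hγ
  rw [qSymbol_pi_sub_two_mul_re hu, Real.cos_pi_sub, Real.cos_two_mul]
  calc qLowerConst γ * (1 - -(2 * Real.cos u ^ 2 - 1))
      = Real.cos u ^ 2 * (2 * qLowerConst γ) := by ring
    _ ≤ (2 * Real.cos u) ^ γ * (γ * Real.cos ((2 - γ) * u) - (2 - γ) * Real.cos (γ * u)) :=
        mul_le_mul (sq_le_two_mul_rpow ⟨by linarith [hγ.1], hγ.2⟩ ⟨hcos, Real.cos_le_one u⟩)
          (two_mul_qLowerConst_le (Set.Ioc_subset_Icc_self hγ) (Set.Ico_subset_Icc_self hu))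
          (by positivity) (by positivity)

lemma qLowerConst_mul_le (hγ : γ ∈ Set.Ioc 1 2) (hξ : ξ ∈ Set.Icc (-Real.pi) Real.pi) :
    qLowerConst γ * (1 - Real.cos ξ) ≤ (qSymbol γ ξ).re := by
  rcases lt_trichotomy ξ 0 with hneg | rfl | hpos
  · simpa only [qSymbol_neg, Real.cos_neg] using
      qLowerConst_mul_le_of_pos hγ (ξ := -ξ) ⟨neg_pos.2 hneg, neg_le.1 hξ.1⟩
  · simp [qSymbol_zero (zero_lt_one.trans hγ.1).ne']
  · exact qLowerConst_mul_le_of_pos hγ ⟨hpos, hξ.2⟩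

end WSGDSymbol

section Discretization

open MeasureTheory

variable {α β d e r s κ : ℝ}

lemma ofReal_Fsymbol_re (α β d e r s : ℝ) (θ : ℝ × ℝ) :
    ((Fsymbol α β d e r s θ).re : ℂ) = Fsymbol α β d e r s θ := by
  rw [← Complex.conj_eq_iff_re]
  simp only [Fsymbol, qSymbol_eq_ofReal, map_add, map_mul, Complex.conj_ofReal]

lemma Fsymbol_re (α β d e r s : ℝ) (θ : ℝ × ℝ) :
    (Fsymbol α β d e r s θ).re = d * (qSymbol α θ.1).re + e * (s / r) * (qSymbol β θ.2).re := by
  rw [Fsymbol, ← Complex.ofReal_mul, Complex.add_re, Complex.re_ofReal_mul, Complex.re_ofReal_mul]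

lemma norm_Fsymbol_le (hα : α ∈ Set.Icc 0 2) (hβ : β ∈ Set.Icc 0 2) (d e r s : ℝ) (θ : ℝ × ℝ) :
    ‖Fsymbol α β d e r s θ‖ ≤ 8 * (|d| + |e| * |s / r|) := by
  refine (norm_add_le _ _).trans ?_
  simp only [norm_mul, Complex.norm_real, Real.norm_eq_abs]
  grw [norm_qSymbol_le hα θ.1, norm_qSymbol_le hβ θ.2]
  exact le_of_eq (by ring)

lemma integrableOn_Fsymbol_re (hα : α ∈ Set.Icc 0 2) (hβ : β ∈ Set.Icc 0 2) (d e r s : ℝ) :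
    IntegrableOn (fun θ => (Fsymbol α β d e r s θ).re) frequencySquare := by
  refine Measure.integrableOn_of_bounded (M := 8 * (|d| + |e| * |s / r|))
    isCompact_frequencySquare.measure_ne_top ?_ ?_
  · unfold Fsymbol
    exact Measurable.aestronglyMeasurable (by fun_prop)
  · exact .of_forall fun θ => (Complex.abs_re_le_norm _).trans (norm_Fsymbol_le hα hβ d e r s θ)

lemma min_qLowerConst_mul_laplaceSymbol_le (hα : α ∈ Set.Ioc 1 2) (hβ : β ∈ Set.Ioc 1 2)
    (hd : 0 ≤ d) (he : 0 ≤ e) (hκ : 0 ≤ κ) (hκsr : κ ≤ s / r) {θ : ℝ × ℝ}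
    (hθ : θ ∈ frequencySquare) :
    min (d * qLowerConst α) (e * κ * qLowerConst β) * laplaceSymbol θ ≤
      (Fsymbol α β d e r s θ).re := by
  have hcos₁ : 0 ≤ 1 - Real.cos θ.1 := sub_nonneg.2 (Real.cos_le_one _)
  have hcos₂ : 0 ≤ 1 - Real.cos θ.2 := sub_nonneg.2 (Real.cos_le_one _)
  have hβ_pos := qLowerConst_pos hβ
  rw [Fsymbol_re, laplaceSymbol, mul_add]
  refine add_le_add ?_ ?_
  · calc _ ≤ d * qLowerConst α * (1 - Real.cos θ.1) := by gcongr; exact min_le_left _ _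
      _ = d * (qLowerConst α * (1 - Real.cos θ.1)) := mul_assoc _ _ _
      _ ≤ d * (qSymbol α θ.1).re := by grw [qLowerConst_mul_le hα hθ.1]
  · have hsr : 0 ≤ s / r := hκ.trans hκsr
    calc _ ≤ e * κ * qLowerConst β * (1 - Real.cos θ.2) := by gcongr; exact min_le_right _ _
      _ ≤ e * (s / r) * qLowerConst β * (1 - Real.cos θ.2) := by gcongr
      _ = e * (s / r) * (qLowerConst β * (1 - Real.cos θ.2)) := mul_assoc _ _ _
      _ ≤ e * (s / r) * (qSymbol β θ.2).re := by grw [qLowerConst_mul_le hβ hθ.2]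

theorem lemma2_general (hα : α ∈ Set.Ioc 1 2) (hβ : β ∈ Set.Ioc 1 2) (hd : 0 < d) (he : 0 < e)
    (hκ : 0 < κ) (K : ℝ) :
    ∃ ξ : ℝ, 0 < ξ ∧ ∀ (n₁ n₂ : ℕ) (r s : ℝ), s / r ∈ Set.Icc κ K →
      (toeplitz₂ n₁ n₂ (Fsymbol α β d e r s)).PosDef ∧
      ∀ x : Fin n₁ × Fin n₂ → ℂ, ∃ y : Fin (coarseSize n₁) × Fin (coarseSize n₂) → ℂ,
        IsMinOn (fun z => energySq (Matrix.diagonal (toeplitz₂ n₁ n₂ (Fsymbol α β d e r s)).diag)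
          (x - (projector n₁ n₂).mulVec z)) Set.univ y ∧
        energySq (Matrix.diagonal (toeplitz₂ n₁ n₂ (Fsymbol α β d e r s)).diag)
          (x - (projector n₁ n₂).mulVec y) ≤
            ξ * energySq (toeplitz₂ n₁ n₂ (Fsymbol α β d e r s)) x := by
  have hα' : α ∈ Set.Icc 0 2 := ⟨by linarith [hα.1], hα.2⟩
  have hβ' : β ∈ Set.Icc 0 2 := ⟨by linarith [hβ.1], hβ.2⟩
  set c := min (d * qLowerConst α) (e * κ * qLowerConst β)
  have hc : 0 < c := lt_min (mul_pos hd (qLowerConst_pos hα))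
    (mul_pos (mul_pos he hκ) (qLowerConst_pos hβ))
  set M := 8 * (d + e * |K|)
  have hM : 0 < M := by positivity
  refine ⟨40 * M / c, by positivity, fun n₁ n₂ r s hsr => ?_⟩
  have hlower : ∀ᵐ θ ∂volume.restrict frequencySquare,
      c * laplaceSymbol θ ≤ (Fsymbol α β d e r s θ).re :=
    (ae_restrict_mem isCompact_frequencySquare.measurableSet).mono fun θ hθ =>
      min_qLowerConst_mul_laplaceSymbol_le hα hβ hd.le he.le hκ.le hsr.1 hθ
  have hupper (θ : ℝ × ℝ) : (Fsymbol α β d e r s θ).re ≤ M := by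
    refine (Complex.re_le_norm _).trans ((norm_Fsymbol_le hα' hβ' d e r s θ).trans ?_)
    rw [abs_of_pos hd, abs_of_pos he]
    have hK : |s / r| ≤ |K| := abs_le_abs_of_nonneg (hκ.le.trans hsr.1) hsr.2
    dsimp only [M]
    gcongr
  have hint := integrableOn_Fsymbol_re hα' hβ' d e r s
  rw [← funext (ofReal_Fsymbol_re α β d e r s)]
  exact ⟨posDef_toeplitz₂_of_laplaceSymbol_le hc hint hlower,
    exists_isMinOn_energySq_sub_projector_mulVec hc hM.le hint hlower (.of_forall hupper)⟩

lemma exists_forall_mem_Icc_of_isTheta_one {f : ℕ → ℝ} (hf : ∀ j, 0 < f j)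
    (h : f =Θ[atTop] fun _ => (1 : ℝ)) : ∃ κ K : ℝ, 0 < κ ∧ ∀ j, f j ∈ Set.Icc κ K := by
  obtain ⟨K, -, hK⟩ := bound_of_isBigO_nat_atTop h.1
  obtain ⟨C, hC, hC'⟩ := bound_of_isBigO_nat_atTop h.2
  refine ⟨C⁻¹, K, inv_pos.2 hC, fun j => ⟨?_, ?_⟩⟩
  · simpa only [norm_one, Real.norm_of_nonneg (hf j).le, inv_le_iff_one_le_mul₀' hC] using
      hC' (hf j).ne'
  · simpa only [norm_one, mul_one, Real.norm_of_nonneg (hf j).le] using hK (x := j) one_ne_zero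

lemma meshParam_pos {Δt h : ℝ} (hΔt : 0 < Δt) (hh : 0 < h) (γ : ℝ) : 0 < meshParam Δt h γ :=
  div_pos hΔt (mul_pos two_pos (Real.rpow_pos_of_pos hh γ))

end Discretization

theorem lemma2
    (α β d e : ℝ) (hα : α ∈ Set.Ioo (1 : ℝ) 2) (hβ : β ∈ Set.Ioo (1 : ℝ) 2)
    (hd : 0 < d) (he : 0 < e)
    (n₁ n₂ : ℕ → ℕ) (hn₁ : ∀ j, Odd (n₁ j)) (hn₂ : ∀ j, Odd (n₂ j))
    (hx hy Δt : ℕ → ℝ) (hx_pos : ∀ j, 0 < hx j) (hy_pos : ∀ j, 0 < hy j)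
    (Δt_pos : ∀ j, 0 < Δt j)
    (r s : ℕ → ℝ) (hr : ∀ j, r j = meshParam (Δt j) (hx j) α)
    (hs : ∀ j, s j = meshParam (Δt j) (hy j) β)
    (hr_small : (fun j => 1 / r j) =o[atTop] (fun _ => (1 : ℝ)))
    (hsr : (fun j => s j / r j) =Θ[atTop] (fun _ => (1 : ℝ)))
    (A : (j : ℕ) → Matrix (Fin (n₁ j) × Fin (n₂ j)) (Fin (n₁ j) × Fin (n₂ j)) ℂ)
    (hA : ∀ j, A j = toeplitz₂ (n₁ j) (n₂ j) (Fsymbol α β d e (r j) (s j))) :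
    (∀ j, (A j).PosDef) ∧
    ∃ ξ : ℝ, 0 < ξ ∧ ∀ j, ∀ x : Fin (n₁ j) × Fin (n₂ j) → ℂ,
      ∃ y : Fin (coarseSize (n₁ j)) × Fin (coarseSize (n₂ j)) → ℂ,
        IsMinOn (fun z => energySq (Matrix.diagonal (A j).diag)
          (x - (projector (n₁ j) (n₂ j)).mulVec z)) Set.univ y ∧
        energySq (Matrix.diagonal (A j).diag)
          (x - (projector (n₁ j) (n₂ j)).mulVec y) ≤ ξ * energySq (A j) x := by
  have hsr_pos (j : ℕ) : 0 < s j / r j := by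
    rw [hr, hs]
    exact div_pos (meshParam_pos (Δt_pos j) (hy_pos j) β) (meshParam_pos (Δt_pos j) (hx_pos j) α)
  obtain ⟨κ, K, hκ, hκK⟩ := exists_forall_mem_Icc_of_isTheta_one hsr_pos hsr
  obtain ⟨ξ, hξ, hbound⟩ := lemma2_general (Set.Ioo_subset_Ioc_self hα) (Set.Ioo_subset_Ioc_self hβ)
    hd he hκ K
  simp only [hA]
  exact ⟨fun j => (hbound _ _ _ _ (hκK j)).1, ξ, hξ, fun j => (hbound _ _ _ _ (hκK j)).2⟩
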